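/- For $N\ge 1$ and $x\in\mathbb{R}^N$ let $E(x)$ be the symmetric positive semi-definite $N\times N$ matrix with entries $E_{ij}(x)=e^{-|x_i-x_j|}$, and let $\sqrt{E(x)}$ be its symmetric positive semi-definite square root. Let $|\cdot|$ be the Euclidean norm. For $a\le b$, an $\mathbb{R}^N$-valued function $\alpha$ defined at least on $(a,b)$ and $y\in\mathbb{R}^N$, a solution on $[a,b]$ with control $\alpha$ and initial point $y$ is an absolutely continuous function $x:[a,b]\to\mathbb{R}^N$ with $x(a)=y$ and $\dot x(t)=\sqrt{E(x(t))}\,\alpha(t)$ for almost every $t\in(a,b)$. Fix $T>0$, let $N=2$, and let $g:\mathbb{R}^2\to\mathbb{R}$ be bounded and continuous. For $(y_0,t_0)\in\mathbb{R}^2\times[0,T]$ put $$v(y_0,t_0)=\inf\left\{\frac12\int_{t_0}^T|\alpha(t)|^2\,dt+g(x(T))\right\},$$ where the infimum is over all measurable controls $\alpha:[0,T]\to\mathbb{R}^2$ and all solutions $x$ on $[t_0,T]$ with control $\alpha$ and initial point $y_0$ (the cost is $+\infty$ if $\alpha$ is not square integrable on $(t_0,T)$). **Theorem.** 1. The infimum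 $v(y_0,t_0)$ is finite for all $(y_0,t_0)\in\mathbb{R}^2\times[0,T]$, and the value function $v:\mathbb{R}^2\times[0,T]\to\mathbb{R}$ is continuous. Moreover $|v(y_0,t_0)|\le\sup_{z\in\mathbb{R}^2}|g(z)|$ for all $(y_0,t_0)$, that is, $\|v\|_{L^\infty}\le\|g\|_{L^\infty}$. 2. Let $y_0\in\mathbb{R}^2$ and $t_0\in[0,T)$, and let $y_n\to y_0$ in $\mathbb{R}^2$. Then for all large $n$ there are $t_n\in[t_0,T]$, a measurable $\alpha_n:[t_0,t_n)\to\mathbb{R}^2$ and a solution $x_n$ on $[t_0,t_n]$ with control $\alpha_n$ and initial point $y_n$ such that $x_n(t_n)=y_0$, and such that $t_n\to t_0$ and $\int_{t_0}^{t_n}|\alpha_n(t)|^2\,dt\to0$ as $n\to\infty$. In particular this holds for $y_0$ on the diagonal $\{x_1=x_2\}$. 3. For every $x\in\mathbb{R}^2$, with $r=e^{-|x_1-x_2|}$, $$\sqrt{E(x)}=\frac12\begin{pmatrix}\sqrt{1+r}+\sqrt{1-r}&\sqrt{1+r}-\sqrt{1-r}\\ \sqrt{1+r}-\sqrt{1-r}&\sqrt{1+r}+\sqrt{1-r}\end{pmatrix}.$$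 -/

import Mathlib

open MeasureTheory Filter Set Topology
open scoped ENNReal Matrix MatrixOrder

noncomputable section

namespace Multipeakon

/-- The symmetric matrix `E(x)` with entries `exp (-|x i - x j|)`. -/
def E {N : ℕ} (x : EuclideanSpace ℝ (Fin N)) : Matrix (Fin N) (Fin N) ℝ :=
  Matrix.of fun i j => Real.exp (-|x i - x j|)

/-- The symmetric positive semi-definite square root of the positive semi-definite matrix
`E(x)`. -/
def sqrtE {N : ℕ} (x : EuclideanSpace ℝ (Fin N)) : Matrix (Fin N) (Fin N) ℝ :=
  CFC.sqrt (E x)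

/-- `IsSolution a b α y x`: the function `x`, regarded on `[a, b]`, is an absolutely continuous
solution of `x' = √E(x) α` almost everywhere on `(a, b)` with `x a = y`.
Values of `x` outside `[a, b]` and of `α` outside `(a, b)` are irrelevant. -/
structure IsSolution {N : ℕ} (a b : ℝ) (α : ℝ → EuclideanSpace ℝ (Fin N))
    (y : EuclideanSpace ℝ (Fin N)) (x : ℝ → EuclideanSpace ℝ (Fin N)) : Prop where
  absolutelyContinuous : AbsolutelyContinuousOnInterval x a b
  hasDerivAt : ∀ᵐ t ∂(volume.restrict (Ioo a b)),
    HasDerivAt x (WithLp.toLp 2 (sqrtE (x t) *ᵥ (α t).ofLp)) t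
  initial : x a = y

/-- The energy `∫_a^b |α(t)|² dt` in `[0, ∞]`, with the Euclidean norm. -/
def energy {N : ℕ} (a b : ℝ) (α : ℝ → EuclideanSpace ℝ (Fin N)) : ℝ≥0∞ :=
  ∫⁻ t in Ioo a b, ‖α t‖ₑ ^ 2

/-- The cost `½ ∫_{t₀}^T |α(t)|² dt + g(x(T))`; it is `⊤` if `α` is not square integrable. -/
def cost {N : ℕ} (T : ℝ) (g : EuclideanSpace ℝ (Fin N) → ℝ) (t₀ : ℝ)
    (α x : ℝ → EuclideanSpace ℝ (Fin N)) : EReal :=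
  ((energy t₀ T α / 2 : ℝ≥0∞) : EReal) + (g (x T) : EReal)

/-- The infimum of the cost, in the extended reals, over all (Lebesgue) measurable controls
`α` on `[0, T]` and all solutions of the state equation on `[t₀, T]` that start at `y₀`. -/
def infCost {N : ℕ} (T : ℝ) (g : EuclideanSpace ℝ (Fin N) → ℝ)
    (y₀ : EuclideanSpace ℝ (Fin N)) (t₀ : ℝ) : EReal :=
  sInf {c : EReal | ∃ α x : ℝ → EuclideanSpace ℝ (Fin N),
    AEMeasurable α (volume.restrict (Icc 0 T)) ∧ IsSolution t₀ T α y₀ x ∧ c = cost T g t₀ α x}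

/-- The value function `v(y₀, t₀)` as a real number (meaningful when `infCost` is finite). -/
def value {N : ℕ} (T : ℝ) (g : EuclideanSpace ℝ (Fin N) → ℝ)
    (y₀ : EuclideanSpace ℝ (Fin N)) (t₀ : ℝ) : ℝ :=
  (infCost T g y₀ t₀).toReal

end Multipeakon

end

/-!
The idea is to straighten the state equation. With `u = x₁ + x₂` and `w = x₁ - x₂` the matrix
`√E(x)` is diagonal, with eigenvalues `√(1 + r)` and `√(1 - r)`, `r = exp (-|w|)`, so the equation
reads `u' = √(1 + r) β₁`, `w' = √(1 - r) β₂` with `β = (α₁ + α₂, α₁ - α₂)`. The second one degenerates on the diagonal `w = 0`,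
but only like `√|w|`, so that the distance `∫ dw / √(1 - r)` from the diagonal is finite. Using it
as a coordinate, that is, writing `w = gap s` with `gap' = √(1 - exp (-|gap|))`, turns the equation
into `u' = √(1 + r) β₁`, `s' = β₂`, which is uniformly nondegenerate. Straight lines in the
coordinates `(u, s)` therefore steer any point to any other in time `δ` with energy at most
`steerCost / δ`, where `steerCost` is continuous and vanishes on the diagonal of pairs
(`exists_isSolution_of_lt`). With `δ = √steerCost + 1 / (n + 1)` this gives the steering sequence.

For the continuity of the value function at a time `t₀ < T`, a trajectory from `(y, t)` is compared
with one from a nearby `(z, s)` that is first steered from `z` to `y` during a short time `δ` and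
then follows the given trajectory at a constant speed factor `k` close to `1`
(`exists_isSolution_same_endpoint`). Both end at the same point, so `g` contributes nothing, and the
energy grows only by `steerCost / δ` and by the factor `k`; near-optimal energies are bounded in
terms of `sup |g|`. This gives `value_le_value_add`, which is used in both directions. At the
terminal time, near-optimal trajectories have no time to move, because the rows of `√E` are unit
vectors (`IsSolution.abs_sub_le`), and continuity of `g` suffices.
-/

/-! ### Gluing and time change of absolutely continuous functions -/

namespace AbsolutelyContinuousOnInterval

variable {X : Type*} [PseudoMetricSpace X] {f : ℝ → X} {a b c d : ℝ}

/-- Absolute continuity on two adjacent intervals gives absolute continuity on their union. -/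
theorem trans (hab : a ≤ b) (hbc : b ≤ c) (h₁ : AbsolutelyContinuousOnInterval f a b)
    (h₂ : AbsolutelyContinuousOnInterval f b c) : AbsolutelyContinuousOnInterval f a c := by
  rw [absolutelyContinuousOnInterval_iff] at *
  intro ε hε
  obtain ⟨δ₁, hδ₁, H₁⟩ := h₁ (ε / 2) (by positivity)
  obtain ⟨δ₂, hδ₂, H₂⟩ := h₂ (ε / 2) (by positivity)
  refine ⟨min δ₁ δ₂, by positivity, ?_⟩
  rintro ⟨n, I⟩ ⟨hI, hdisj⟩ hsum
  simp only [uIcc_of_le (hab.trans hbc)] at hI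
  -- Cut every interval at `b`: its two parts lie in `[a, b]` and in `[b, c]`.
  have K₁ := H₁ (n, fun i => (min (I i).1 b, min (I i).2 b)) ⟨fun i hi => by
      have := hI i hi
      simp only [uIcc_of_le hab, mem_Icc] at this ⊢
      grind, fun i hi j hj hij => (hdisj hi hj hij).mono (fun z hz => by
        simp only [mem_uIoc] at hz ⊢; grind) (fun z hz => by
        simp only [mem_uIoc] at hz ⊢; grind)⟩
    ((Finset.sum_le_sum fun i _ => by simp only [Real.dist_eq]; grind).trans_lt
      (hsum.trans_le (min_le_left _ _)))
  have K₂ := H₂ (n, fun i => (max (I i).1 b, max (I i).2 b)) ⟨fun i hi => by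
      have := hI i hi
      simp only [uIcc_of_le hbc, mem_Icc] at this ⊢
      grind, fun i hi j hj hij => (hdisj hi hj hij).mono (fun z hz => by
        simp only [mem_uIoc] at hz ⊢; grind) (fun z hz => by
        simp only [mem_uIoc] at hz ⊢; grind)⟩
    ((Finset.sum_le_sum fun i _ => by simp only [Real.dist_eq]; grind).trans_lt
      (hsum.trans_le (min_le_right _ _)))
  have key : ∀ u v : ℝ, dist (f u) (f v) ≤
      dist (f (min u b)) (f (min v b)) + dist (f (max u b)) (f (max v b)) := by
    intro u v
    rcases le_total u b with hu | hu <;> rcases le_total v b with hv | hv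
    · simp [hu, hv]
    · simpa [hu, hv] using dist_triangle (f u) (f b) (f v)
    · simpa [hu, hv, add_comm] using dist_triangle (f u) (f b) (f v)
    · simp [hu, hv]
  calc _ ≤ _ := Finset.sum_le_sum fun i _ => key (I i).1 (I i).2
    _ = _ := Finset.sum_add_distrib
    _ < ε := by linarith [K₁, K₂]

theorem congr {g : ℝ → X} (h : AbsolutelyContinuousOnInterval f a b)
    (hfg : EqOn f g (uIcc a b)) : AbsolutelyContinuousOnInterval g a b := by
  rw [absolutelyContinuousOnInterval_iff] at *
  intro ε hε
  obtain ⟨δ, hδ, H⟩ := h ε hε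
  refine ⟨δ, hδ, fun E hE hs => ?_⟩
  rw [← Finset.sum_congr rfl fun i hi => by rw [← hfg (hE.1 i hi).1, ← hfg (hE.1 i hi).2]]
  exact H E hE hs

theorem comp_affine {k : ℝ} (hk : 0 < k) (hcd : c ≤ d)
    (h : AbsolutelyContinuousOnInterval f a (a + k * (d - c))) :
    AbsolutelyContinuousOnInterval (fun s => f (a + k * (s - c))) c d := by
  rw [absolutelyContinuousOnInterval_iff] at *
  intro ε hε
  obtain ⟨δ, hδ, H⟩ := h ε hε
  refine ⟨δ / k, by positivity, ?_⟩
  have hmono : ∀ u v : ℝ, a + k * (u - c) ≤ a + k * (v - c) ↔ u ≤ v := fun u v => by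
    rw [add_le_add_iff_left, mul_le_mul_iff_right₀ hk, sub_le_sub_iff_right]
  rintro ⟨n, I⟩ ⟨hI, hdisj⟩ hsum
  simp only [uIcc_of_le hcd] at hI
  have hle : a ≤ a + k * (d - c) := by
    have := mul_nonneg hk.le (sub_nonneg.2 hcd); linarith
  refine H (n, fun i => (a + k * ((I i).1 - c), a + k * ((I i).2 - c))) ⟨fun i hi => ?_, ?_⟩ ?_
  · have := hI i hi
    have hac : a = a + k * (c - c) := by simp
    rw [uIcc_of_le hle]
    refine ⟨⟨?_, (hmono _ _).2 this.1.2⟩, ⟨?_, (hmono _ _).2 this.2.2⟩⟩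
    · rw [hac]; simpa using (hmono _ _).2 this.1.1
    · rw [hac]; simpa using (hmono _ _).2 this.2.1
  · intro i hi j hj hij
    have := hdisj hi hj hij
    simp only [Function.onFun] at this ⊢
    rw [Set.disjoint_left] at this ⊢
    intro z hz hz'
    have hz0 : z = a + k * ((c + (z - a) / k) - c) := by field_simp; ring
    rw [hz0] at hz hz'
    refine this (a := c + (z - a) / k) ?_ ?_
    · simpa only [mem_uIoc, hmono, ← not_le] using hz
    · simpa only [mem_uIoc, hmono, ← not_le] using hz'
  · have : ∀ u v : ℝ, dist (a + k * (u - c)) (a + k * (v - c)) = k * dist u v := fun u v => by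
      rw [Real.dist_eq, Real.dist_eq, ← abs_of_pos hk, ← abs_mul, abs_of_pos hk]
      congr 1; ring
    simp only [this, ← Finset.mul_sum]
    rwa [lt_div_iff₀' hk] at hsum

end AbsolutelyContinuousOnInterval

namespace Multipeakon

/-! ### The square root in dimension two -/

theorem sqrtE_fin_two (z : EuclideanSpace ℝ (Fin 2)) :
    sqrtE z = (1 / 2 : ℝ) •
      !![√(1 + Real.exp (-|z 0 - z 1|)) + √(1 - Real.exp (-|z 0 - z 1|)),
         √(1 + Real.exp (-|z 0 - z 1|)) - √(1 - Real.exp (-|z 0 - z 1|));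
         √(1 + Real.exp (-|z 0 - z 1|)) - √(1 - Real.exp (-|z 0 - z 1|)),
         √(1 + Real.exp (-|z 0 - z 1|)) + √(1 - Real.exp (-|z 0 - z 1|))] := by
  have hr0 : 0 < Real.exp (-|z 0 - z 1|) := Real.exp_pos _
  have hr1 : Real.exp (-|z 0 - z 1|) ≤ 1 := by simp
  have hp := Real.sq_sqrt (show 0 ≤ 1 + Real.exp (-|z 0 - z 1|) by linarith)
  have hq := Real.sq_sqrt (show 0 ≤ 1 - Real.exp (-|z 0 - z 1|) by linarith)
  have hp0 := Real.sqrt_nonneg (1 + Real.exp (-|z 0 - z 1|))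
  have hq0 := Real.sqrt_nonneg (1 - Real.exp (-|z 0 - z 1|))
  have hE : E z = !![1, Real.exp (-|z 0 - z 1|); Real.exp (-|z 0 - z 1|), 1] := by
    ext i j
    fin_cases i <;> fin_cases j <;> simp [E, abs_sub_comm]
  rw [sqrtE]
  refine CFC.sqrt_unique ?_ ?_
  · rw [hE]
    ext i j
    fin_cases i <;> fin_cases j <;> simp [Matrix.mul_apply, Fin.sum_univ_two] <;> nlinarith
  · rw [Matrix.nonneg_iff_posSemidef]
    refine Matrix.PosSemidef.smul ?_ (by norm_num)
    refine Matrix.PosSemidef.of_dotProduct_mulVec_nonneg ?_ fun v => ?_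
    · ext i j
      fin_cases i <;> fin_cases j <;> simp
    · simp only [Matrix.mulVec, dotProduct, Fin.sum_univ_two, Matrix.of_apply, Pi.star_apply,
        star_trivial, Matrix.cons_val_zero, Matrix.cons_val_one]
      generalize √(1 + Real.exp (-|z 0 - z 1|)) = p at *
      generalize √(1 - Real.exp (-|z 0 - z 1|)) = q at *
      have := mul_nonneg hp0 (sq_nonneg (v 0 + v 1))
      have := mul_nonneg hq0 (sq_nonneg (v 0 - v 1))
      nlinarith

end Multipeakon

/-! ### Gluing and time change of solutions -/

namespace Multipeakon

section Solutions

variable {N : ℕ} {a b c k : ℝ} {y : EuclideanSpace ℝ (Fin N)}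
  {α β x z : ℝ → EuclideanSpace ℝ (Fin N)}

theorem IsSolution.glue (hab : a ≤ b) (hbc : b ≤ c) (h₁ : IsSolution a b α y x)
    (h₂ : IsSolution b c β (x b) z) :
    IsSolution a c ((Iic b).piecewise α β) y ((Iic b).piecewise x z) := by
  have hxz : EqOn z ((Iic b).piecewise x z) (uIcc b c) := by
    intro t ht
    rw [uIcc_of_le hbc] at ht
    rcases ht.1.eq_or_lt with rfl | h
    · simp [h₂.initial]
    · rw [piecewise_eq_of_notMem _ _ _ (by simpa using h)]
  refine ⟨.trans hab hbc (h₁.absolutelyContinuous.congr fun t ht => ?_)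
    (h₂.absolutelyContinuous.congr hxz), ?_, ?_⟩
  · rw [uIcc_of_le hab] at ht
    rw [piecewise_eq_of_mem _ _ _ (by simpa using ht.2)]
  · have hb : ∀ᵐ t ∂(volume : Measure ℝ), t ≠ b := by simp [ae_iff, measure_singleton]
    have H₁ := (ae_restrict_iff' measurableSet_Ioo).1 h₁.hasDerivAt
    have H₂ := (ae_restrict_iff' measurableSet_Ioo).1 h₂.hasDerivAt
    rw [ae_restrict_iff' measurableSet_Ioo]
    filter_upwards [hb, H₁, H₂] with t htb ht₁ ht₂ ht
    rcases lt_or_gt_of_ne htb with h | h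
    · rw [piecewise_eq_of_mem _ _ _ (by simpa using h.le),
        piecewise_eq_of_mem _ _ _ (by simpa using h.le)]
      refine (ht₁ ⟨ht.1, h⟩).congr_of_eventuallyEq ?_
      filter_upwards [Iio_mem_nhds h] with s hs
      rw [piecewise_eq_of_mem _ _ _ (mem_Iic.2 (le_of_lt hs))]
    · rw [piecewise_eq_of_notMem _ _ _ (by simpa using h),
        piecewise_eq_of_notMem _ _ _ (by simpa using h)]
      refine (ht₂ ⟨h, ht.2⟩).congr_of_eventuallyEq ?_
      filter_upwards [Ioi_mem_nhds h] with s hs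
      rw [piecewise_eq_of_notMem _ _ _ (by simpa using hs)]
  · rw [piecewise_eq_of_mem _ _ _ (by simpa using hab), h₁.initial]

theorem energy_glue_le :
    energy a c ((Iic b).piecewise α β) ≤ energy a b α + energy b c β := by
  have hsub : Ioo a c ⊆ Ioc a b ∪ Ioo b c := by
    intro t ht
    rcases le_or_gt t b with h | h
    · exact Or.inl ⟨ht.1, h⟩
    · exact Or.inr ⟨h, ht.2⟩
  refine (lintegral_mono_set hsub).trans ((lintegral_union_le _ _ _).trans ?_)
  rw [← restrict_Ioo_eq_restrict_Ioc]
  refine add_le_add (le_of_eq ?_) (le_of_eq ?_)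
  · refine setLIntegral_congr_fun measurableSet_Ioo fun t ht => ?_
    simp only [piecewise_eq_of_mem _ _ _ (mem_Iic.2 ht.2.le)]
  · refine setLIntegral_congr_fun measurableSet_Ioo fun t ht => ?_
    simp only [piecewise_eq_of_notMem (Iic b) α β (by simpa using ht.1)]

theorem aemeasurable_glue (hα : AEMeasurable α (volume.restrict (Icc a b)))
    (hβ : AEMeasurable β (volume.restrict (Ioc b c))) :
    AEMeasurable ((Iic b).piecewise α β) (volume.restrict (Icc a c)) := by
  have hsub : Icc a c ⊆ Icc a b ∪ Ioc b c := by
    intro t ht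
    rcases le_or_gt t b with h | h
    · exact Or.inl ⟨ht.1, h⟩
    · exact Or.inr ⟨h, ht.2⟩
  refine AEMeasurable.mono_measure ?_ (Measure.restrict_mono hsub le_rfl)
  refine aemeasurable_union_iff.2 ⟨hα.congr ?_, hβ.congr ?_⟩
  · filter_upwards [ae_restrict_mem measurableSet_Icc] with t ht
    rw [piecewise_eq_of_mem _ _ _ (mem_Iic.2 ht.2)]
  · filter_upwards [ae_restrict_mem measurableSet_Ioc] with t ht
    rw [piecewise_eq_of_notMem _ _ _ (by simpa using ht.1)]

theorem quasiMeasurePreserving_affine (a c : ℝ) (hk : k ≠ 0) :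
    Measure.QuasiMeasurePreserving (fun s : ℝ => a + k * (s - c)) volume volume := by
  have h₁ : Measure.QuasiMeasurePreserving (fun s : ℝ => k * s) volume volume :=
    ⟨by fun_prop, by rw [Real.map_volume_mul_left hk]; exact Measure.smul_absolutelyContinuous⟩
  exact ((measurePreserving_add_left volume a).quasiMeasurePreserving.comp h₁).comp
    (measurePreserving_sub_right volume c).quasiMeasurePreserving

theorem hasDerivAt_affine (a k c s : ℝ) : HasDerivAt (fun s : ℝ => a + k * (s - c)) k s := by
  simpa using (((hasDerivAt_id s).sub_const c).const_mul k).const_add a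

theorem mapsTo_affine (hk : 0 < k) (a c d : ℝ) :
    MapsTo (fun s : ℝ => a + k * (s - c)) (Ioo c d) (Ioo a (a + k * (d - c))) := by
  intro s hs
  have := mul_pos hk (sub_pos.2 hs.1)
  have := mul_lt_mul_of_pos_left (sub_lt_sub_right hs.2 c) hk
  exact ⟨by linarith, by linarith⟩

theorem IsSolution.comp_affine {d : ℝ} (hk : 0 < k) (hcd : c ≤ d)
    (h : IsSolution a (a + k * (d - c)) α y x) :
    IsSolution c d (fun s => k • α (a + k * (s - c))) y (fun s => x (a + k * (s - c))) := by
  refine ⟨h.absolutelyContinuous.comp_affine hk hcd, ?_, by simp [h.initial]⟩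
  have H := ((quasiMeasurePreserving_affine a c hk.ne').restrict (mapsTo_affine hk a c d)).ae
    h.hasDerivAt
  filter_upwards [H] with s hs
  convert! hs.scomp s (hasDerivAt_affine a k c s) using 1
  ext i
  simp [Matrix.mulVec_smul]

theorem energy_comp_affine {d : ℝ} (hk : 0 < k) :
    energy c d (fun s => k • α (a + k * (s - c))) =
      ENNReal.ofReal k * energy a (a + k * (d - c)) α := by
  have himage : (fun s : ℝ => a + k * (s - c)) '' Ioo c d = Ioo a (a + k * (d - c)) := by
    refine Subset.antisymm (mapsTo_affine hk a c d).image_subset fun t ht => ?_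
    refine ⟨c + (t - a) / k, ⟨?_, ?_⟩, by field_simp; ring⟩
    · have := div_pos (sub_pos.2 ht.1) hk
      linarith
    · have : (t - a) / k < d - c := by rw [div_lt_iff₀' hk]; linarith [ht.2]
      linarith
  have hcv := lintegral_image_eq_lintegral_abs_deriv_mul (measurableSet_Ioo (a := c) (b := d))
    (fun s _ => (hasDerivAt_affine a k c s).hasDerivWithinAt)
    (fun s _ t _ hst => by simpa [hk.ne'] using hst) (fun t => ‖α t‖ₑ ^ 2)
  rw [himage] at hcv
  rw [energy, energy, hcv, ← lintegral_const_mul' _ _ ENNReal.ofReal_ne_top]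
  refine lintegral_congr fun s => ?_
  rw [enorm_smul, mul_pow, sq, ← mul_assoc, abs_of_pos hk, Real.enorm_of_nonneg hk.le]

theorem aemeasurable_comp_affine {d e : ℝ} (hk : 0 < k) (hac : e ≤ a)
    (hα : AEMeasurable α (volume.restrict (Icc e (a + k * (d - c))))) :
    AEMeasurable (fun s => k • α (a + k * (s - c))) (volume.restrict (Ioc c d)) := by
  refine AEMeasurable.const_smul (hα.comp_quasiMeasurePreserving
    ((quasiMeasurePreserving_affine a c hk.ne').restrict fun s hs => ?_)) k
  have := mul_pos hk (sub_pos.2 hs.1)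
  have := mul_le_mul_of_nonneg_left (sub_le_sub_right hs.2 c) hk.le
  exact ⟨by linarith, by linarith⟩

end Solutions

end Multipeakon

/-! ### Straightening the equation and steering along straight lines -/

namespace Multipeakon

/-- The solution of `gap' = √(1 - exp (-|gap|))` that crosses zero at `0`: the odd function which is
`2 log (cosh (s / 2))` for `s ≥ 0`. It recovers `x₁ - x₂` from the straightened coordinate `s`. -/
noncomputable def gap (s : ℝ) : ℝ :=
  if 0 ≤ s then 2 * Real.log (Real.cosh (s / 2)) else -(2 * Real.log (Real.cosh (s / 2)))

/-- The inverse of `gap`, the straightened coordinate of `w = x₁ - x₂`. In closed form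
`sinh (s / 2) = sign w * √(exp |w| - 1)`; since `√` vanishes on negative reals, the difference of
square roots below covers both signs of `w`. -/
noncomputable def gapInv (w : ℝ) : ℝ :=
  2 * Real.arsinh (√(Real.exp w - 1) - √(Real.exp (-w) - 1))

theorem continuous_gapInv : Continuous gapInv := by
  have h : Continuous fun w : ℝ => √(Real.exp w - 1) - √(Real.exp (-w) - 1) := by fun_prop
  exact h.arsinh.const_mul 2

theorem hasDerivAt_gap (s : ℝ) :
    HasDerivAt gap |Real.sinh (s / 2) / Real.cosh (s / 2)| s := by
  have hf : ∀ s : ℝ, HasDerivAt (fun s => 2 * Real.log (Real.cosh (s / 2)))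
      (Real.sinh (s / 2) / Real.cosh (s / 2)) s := fun s => by
    convert! (((((hasDerivAt_id s).div_const 2).cosh).log (Real.cosh_pos _).ne').const_mul 2)
      using 1
    simp only [id]
    ring
  have hpos : ∀ s, 0 ≤ s → HasDerivWithinAt gap |Real.sinh (s / 2) / Real.cosh (s / 2)|
      (Ici 0) s := fun s hs => by
    rw [abs_of_nonneg (div_nonneg (Real.sinh_nonneg_iff.2 (by linarith)) (Real.cosh_pos _).le)]
    exact (hf s).hasDerivWithinAt.congr (fun t ht => if_pos ht) (if_pos hs)
  have hneg : ∀ s, s ≤ 0 → HasDerivWithinAt gap |Real.sinh (s / 2) / Real.cosh (s / 2)|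
      (Iic 0) s := fun s hs => by
    have heq : ∀ t ≤ 0, gap t = -(2 * Real.log (Real.cosh (t / 2))) := fun t ht => by
      rcases ht.eq_or_lt with rfl | h
      · simp [gap]
      · exact if_neg (not_le.2 h)
    rw [abs_of_nonpos (div_nonpos_of_nonpos_of_nonneg (Real.sinh_nonpos_iff.2 (by linarith))
      (Real.cosh_pos _).le)]
    exact (hf s).neg.hasDerivWithinAt.congr (fun t ht => heq t ht) (heq s hs)
  rcases lt_trichotomy s 0 with h | rfl | h
  · exact (hneg s h.le).hasDerivAt (Iic_mem_nhds h)
  · have := (hneg 0 le_rfl).union (hpos 0 le_rfl)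
    rwa [Iic_union_Ici, hasDerivWithinAt_univ] at this
  · exact (hpos s h.le).hasDerivAt (Ici_mem_nhds h)

theorem contDiff_gap : ContDiff ℝ 1 gap := by
  rw [contDiff_one_iff_deriv]
  refine ⟨fun s => (hasDerivAt_gap s).differentiableAt, ?_⟩
  rw [show deriv gap = _ from funext fun s => (hasDerivAt_gap s).deriv]
  exact ((Real.continuous_sinh.comp (continuous_id.div_const 2)).div
    (Real.continuous_cosh.comp (continuous_id.div_const 2)) fun s => (Real.cosh_pos _).ne').abs

theorem gap_gapInv (w : ℝ) : gap (gapInv w) = w := by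
  have hlog : ∀ v : ℝ, 0 ≤ v → 2 * Real.log (√(1 + √(Real.exp v - 1) ^ 2)) = v := fun v hv => by
    rw [Real.sq_sqrt (by simpa using hv), add_sub_cancel, Real.log_sqrt (Real.exp_pos _).le,
      Real.log_exp]
    ring
  rcases le_or_gt 0 w with h | h
  · have h' : √(Real.exp (-w) - 1) = 0 := Real.sqrt_eq_zero_of_nonpos (by simpa using h)
    rw [gapInv, h', sub_zero, gap, if_pos (by simp [Real.arsinh_nonneg_iff]),
      mul_div_cancel_left₀ _ two_ne_zero, Real.cosh_arsinh, hlog w h]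
  · have h' : √(Real.exp w - 1) = 0 := Real.sqrt_eq_zero_of_nonpos (by simpa using h.le)
    have h'' : 0 < √(Real.exp (-w) - 1) := Real.sqrt_pos.2 (by simpa using h)
    rw [gapInv, h', zero_sub, gap, if_neg (by simpa [Real.arsinh_neg] using h''),
      mul_div_cancel_left₀ _ two_ne_zero, Real.cosh_arsinh, neg_sq, hlog (-w) (by linarith), neg_neg]

/-- The smaller eigenvalue of `√E` at the state with straightened coordinate `s` is `gap' s`. -/
theorem sqrt_one_sub_exp_gap (s : ℝ) :
    √(1 - Real.exp (-|gap s|)) = |Real.sinh (s / 2) / Real.cosh (s / 2)| := by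
  have hc := Real.cosh_pos (s / 2)
  have habs : |gap s| = 2 * Real.log (Real.cosh (s / 2)) := by
    have : 0 ≤ 2 * Real.log (Real.cosh (s / 2)) :=
      mul_nonneg zero_le_two (Real.log_nonneg (Real.one_le_cosh _))
    unfold gap
    split_ifs <;> simp [abs_of_nonneg this]
  rw [habs, ← Real.sqrt_sq_eq_abs, Real.exp_neg, two_mul, Real.exp_add, Real.exp_log hc]
  congr 1
  field_simp
  linarith [Real.cosh_sq (s / 2)]

/-- The state `x` with `x₁ + x₂ = u` and `x₁ - x₂ = gap s`. -/
noncomputable def ofSumGap (u s : ℝ) : EuclideanSpace ℝ (Fin 2) :=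
  !₂[(u + gap s) / 2, (u - gap s) / 2]

/-- The larger eigenvalue `√(1 + r)` of `√E` at the states with `x₁ - x₂ = gap s`. -/
noncomputable def steerRate (s : ℝ) : ℝ := √(1 + Real.exp (-|gap s|))

theorem one_le_steerRate (s : ℝ) : 1 ≤ steerRate s :=
  Real.one_le_sqrt.2 (by linarith [Real.exp_pos (-|gap s|)])

theorem continuous_steerRate : Continuous steerRate := by
  have := contDiff_gap.continuous
  unfold steerRate
  fun_prop

theorem ofSumGap_gapInv (z : EuclideanSpace ℝ (Fin 2)) :
    ofSumGap (z 0 + z 1) (gapInv (z 0 - z 1)) = z := by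
  ext i
  fin_cases i <;> simp [ofSumGap, gap_gapInv]

theorem sqrtE_ofSumGap_mulVec (u s p q : ℝ) :
    sqrtE (ofSumGap u s) *ᵥ ![(p + q) / 2, (p - q) / 2] =
      ![(steerRate s * p + |Real.sinh (s / 2) / Real.cosh (s / 2)| * q) / 2,
        (steerRate s * p - |Real.sinh (s / 2) / Real.cosh (s / 2)| * q) / 2] := by
  have hw : ofSumGap u s 0 - ofSumGap u s 1 = gap s := by
    simp [ofSumGap]; ring
  rw [sqrtE_fin_two, hw, sqrt_one_sub_exp_gap, ← steerRate]
  ext i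
  fin_cases i <;> simp [Matrix.mulVec, dotProduct, Fin.sum_univ_two] <;> ring

/-- Steering along the straight line from `(u₀, s₀)` to `(u₁, s₁)` in the straightened coordinates,
at constant speed. -/
theorem exists_steering {a b : ℝ} (hab : a < b) (u₀ u₁ s₀ s₁ : ℝ) :
    ∃ α x : ℝ → EuclideanSpace ℝ (Fin 2), Measurable α ∧
      IsSolution a b α (ofSumGap u₀ s₀) x ∧ x b = ofSumGap u₁ s₁ ∧
      energy a b α ≤ ENNReal.ofReal (((u₁ - u₀) ^ 2 + (s₁ - s₀) ^ 2) / 2 / (b - a)) := by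
  have hba : 0 < b - a := sub_pos.2 hab
  set p := (u₁ - u₀) / (b - a) with hp
  set q := (s₁ - s₀) / (b - a) with hq
  set u : ℝ → ℝ := fun t => u₀ + p * (t - a) with hu
  set s : ℝ → ℝ := fun t => s₀ + q * (t - a) with hs
  have hsc : Continuous s := by fun_prop
  have hs' : ∀ t, HasDerivAt s q t := hasDerivAt_affine s₀ q a
  have hu' : ∀ t, HasDerivAt u p t := hasDerivAt_affine u₀ p a
  have hr : ∀ t, steerRate (s t) ≠ 0 := fun t => (one_pos.trans_le (one_le_steerRate _)).ne'
  refine ⟨fun t => !₂[(p / steerRate (s t) + q) / 2, (p / steerRate (s t) - q) / 2],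
    fun t => ofSumGap (u t) (s t), ?_, ⟨?_, ?_, by simp [hu, hs]⟩, ?_, ?_⟩
  · have hc : Continuous fun t => p / steerRate (s t) :=
      continuous_const.div (continuous_steerRate.comp hsc) hr
    refine Continuous.measurable ((PiLp.continuous_toLp 2 _).comp (continuous_pi fun i => ?_))
    fin_cases i
    · exact (hc.add continuous_const).div_const 2
    · exact (hc.sub continuous_const).div_const 2
  · refine ContDiffOn.absolutelyContinuousOnInterval (ContDiff.contDiffOn ?_)
    have hsC : ContDiff ℝ 1 s := by fun_prop
    have huC : ContDiff ℝ 1 u := by fun_prop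
    have hg := contDiff_gap.comp hsC
    rw [contDiff_euclidean]
    intro i
    fin_cases i
    · exact (huC.add hg).div_const 2
    · exact (huC.sub hg).div_const 2
  · refine Eventually.of_forall fun t => ?_
    have hg := (hasDerivAt_gap (s t)).comp t (hs' t)
    rw [sqrtE_ofSumGap_mulVec, mul_div_cancel₀ _ (hr t)]
    have hpi : HasDerivAt (fun t => ![(u t + gap (s t)) / 2, (u t - gap (s t)) / 2])
        ![(p + |Real.sinh (s t / 2) / Real.cosh (s t / 2)| * q) / 2,
          (p - |Real.sinh (s t / 2) / Real.cosh (s t / 2)| * q) / 2] t := by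
      refine hasDerivAt_pi.2 fun i => ?_
      fin_cases i
      · exact ((hu' t).add hg).div_const 2
      · exact ((hu' t).sub hg).div_const 2
    exact (PiLp.continuousLinearEquiv 2 ℝ fun _ : Fin 2 => ℝ).symm.hasFDerivAt.comp_hasDerivAt t
      hpi
  · have h1 : u b = u₁ := by simp only [hu, hp]; field_simp; ring
    have h2 : s b = s₁ := by simp only [hs, hq]; field_simp; ring
    simp only [h1, h2]
  · calc energy a b _ ≤ ∫⁻ _ in Ioo a b, ENNReal.ofReal ((p ^ 2 + q ^ 2) / 2) := by
          refine lintegral_mono fun t => ?_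
          rw [← ofReal_norm, ← ENNReal.ofReal_pow (norm_nonneg _), EuclideanSpace.norm_sq_eq]
          refine ENNReal.ofReal_le_ofReal ?_
          have : (p / steerRate (s t)) ^ 2 ≤ p ^ 2 := by
            rw [div_pow]
            exact div_le_self (sq_nonneg _) (one_le_pow₀ (one_le_steerRate _))
          simp only [Fin.sum_univ_two, Real.norm_eq_abs, sq_abs,
            Matrix.cons_val_zero, Matrix.cons_val_one]
          nlinarith
      _ = ENNReal.ofReal (((u₁ - u₀) ^ 2 + (s₁ - s₀) ^ 2) / 2 / (b - a)) := by
          rw [setLIntegral_const, Real.volume_Ioo, ← ENNReal.ofReal_mul (by positivity)]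
          congr 1
          simp only [hp, hq]
          field_simp

end Multipeakon

/-! ### Displacement bound and comparison of trajectories -/

namespace Multipeakon

/-- The rows of `√E` are unit vectors, because the diagonal entries of `E` are `1`. -/
theorem abs_sqrtE_mulVec_le (z v : EuclideanSpace ℝ (Fin 2)) (i : Fin 2) :
    |(sqrtE z *ᵥ v.ofLp) i| ≤ ‖v‖ := by
  have hr1 : Real.exp (-|z 0 - z 1|) ≤ 1 := by simp
  have hp := Real.sq_sqrt (show 0 ≤ 1 + Real.exp (-|z 0 - z 1|) by positivity)
  have hq := Real.sq_sqrt (show 0 ≤ 1 - Real.exp (-|z 0 - z 1|) by linarith)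
  rw [sqrtE_fin_two, EuclideanSpace.norm_eq]
  refine Real.abs_le_sqrt ?_
  generalize √(1 + Real.exp (-|z 0 - z 1|)) = p at *
  generalize √(1 - Real.exp (-|z 0 - z 1|)) = q at *
  have key : ∀ m n : ℝ, ((p + q) / 2 * m + (p - q) / 2 * n) ^ 2 ≤ m ^ 2 + n ^ 2 := fun m n => by
    have hpq : p ^ 2 + q ^ 2 = 2 := by linarith
    have h : ((p + q) / 2 * m + (p - q) / 2 * n) ^ 2 + ((p - q) / 2 * m - (p + q) / 2 * n) ^ 2
        = (p ^ 2 + q ^ 2) / 2 * (m ^ 2 + n ^ 2) := by ring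
    rw [hpq] at h
    linarith [sq_nonneg ((p - q) / 2 * m - (p + q) / 2 * n)]
  fin_cases i
  · simp [Matrix.mulVec, dotProduct, Fin.sum_univ_two]
    convert! key (v 0) (v 1) using 1
    ring
  · simp [Matrix.mulVec, dotProduct, Fin.sum_univ_two]
    convert! key (v 1) (v 0) using 1 <;> ring

/-- A solution of energy `K` moves by at most `√(T - t) (1 + K) / 2` in each coordinate. -/
theorem IsSolution.abs_sub_le {t T : ℝ} {y : EuclideanSpace ℝ (Fin 2)}
    {α x : ℝ → EuclideanSpace ℝ (Fin 2)} (htT : t ≤ T) (h : IsSolution t T α y x)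
    (hα : energy t T α ≠ ⊤) (i : Fin 2) :
    |x T i - y i| ≤ √(T - t) / 2 * (1 + (energy t T α).toReal) := by
  rcases htT.eq_or_lt with rfl | htT'
  · simp [h.initial]
  set r := √(T - t) with hr
  have hr0 : 0 < r := Real.sqrt_pos.2 (sub_pos.2 htT')
  have hr2 : r ^ 2 = T - t := Real.sq_sqrt (sub_nonneg.2 htT)
  have hac : AbsolutelyContinuousOnInterval (fun s => x s i) t T := by
    refine squeeze_zero (fun _ => Finset.sum_nonneg fun _ _ => dist_nonneg)
      (fun _ => Finset.sum_le_sum fun j _ => ?_) h.absolutelyContinuous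
    rw [dist_eq_norm, dist_eq_norm, ← PiLp.sub_apply]
    exact PiLp.norm_apply_le _ i
  -- Young's inequality with weight `r` bounds `∫ |α|` without any measurability of `α`.
  have hpt : ∀ s, ‖α s‖ₑ ≤ ENNReal.ofReal (1 / (2 * r)) + ENNReal.ofReal (r / 2) * ‖α s‖ₑ ^ 2 := by
    intro s
    rw [← ofReal_norm, ← ENNReal.ofReal_pow (norm_nonneg _),
      ← ENNReal.ofReal_mul (by positivity), ← ENNReal.ofReal_add (by positivity) (by positivity)]
    refine ENNReal.ofReal_le_ofReal ?_
    have : 1 / (2 * r) + r / 2 * ‖α s‖ ^ 2 - ‖α s‖ = (r * ‖α s‖ - 1) ^ 2 / (2 * r) := by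
      field_simp; ring
    have : 0 ≤ (r * ‖α s‖ - 1) ^ 2 / (2 * r) := by positivity
    linarith
  have hder : ∀ᵐ s ∂volume.restrict (Ioo t T), ‖deriv (fun s => x s i) s‖ₑ ≤ ‖α s‖ₑ := by
    filter_upwards [h.hasDerivAt] with s hs
    have hs' : HasDerivAt (fun s => x s i) ((sqrtE (x s) *ᵥ (α s).ofLp) i) s :=
      (EuclideanSpace.proj (𝕜 := ℝ) i).hasFDerivAt.comp_hasDerivAt s hs
    rw [hs'.deriv, ← ofReal_norm, ← ofReal_norm]
    exact ENNReal.ofReal_le_ofReal (abs_sqrtE_mulVec_le _ _ _)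
  have hmain : ENNReal.ofReal |x T i - y i| ≤
      ENNReal.ofReal (r / 2 * (1 + (energy t T α).toReal)) := by
    calc ENNReal.ofReal |x T i - y i| = ‖∫ s in t..T, deriv (fun s => x s i) s‖ₑ := by
          rw [hac.integral_deriv_eq_sub, ← ofReal_norm, Real.norm_eq_abs, h.initial]
      _ ≤ ∫⁻ s in Ioo t T, ‖deriv (fun s => x s i) s‖ₑ := by
          rw [intervalIntegral.integral_of_le htT, restrict_Ioo_eq_restrict_Ioc]
          exact enorm_integral_le_lintegral_enorm _
      _ ≤ ∫⁻ s in Ioo t T, (ENNReal.ofReal (1 / (2 * r)) + ENNReal.ofReal (r / 2) * ‖α s‖ₑ ^ 2) :=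
          lintegral_mono_ae (hder.mono fun s hs => hs.trans (hpt s))
      _ = ENNReal.ofReal (r / 2) + ENNReal.ofReal (r / 2) * energy t T α := by
          rw [lintegral_add_left measurable_const, lintegral_const_mul' _ _ ENNReal.ofReal_ne_top,
            setLIntegral_const, Real.volume_Ioo, ← ENNReal.ofReal_mul (by positivity), ← hr2, energy]
          congr 2
          field_simp
      _ = _ := by
          rw [mul_add, mul_one, ENNReal.ofReal_add (by positivity) (by positivity),
            ENNReal.ofReal_mul (by positivity : 0 ≤ r / 2), ENNReal.ofReal_toReal hα]
  exact (ENNReal.ofReal_le_ofReal_iff (by positivity)).1 hmain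

/-- Half the squared distance of two states in the straightened coordinates
`(x₁ + x₂, gapInv (x₁ - x₂))`; divided by `δ` it bounds the energy of steering in time `δ`. -/
noncomputable def steerCost (z w : EuclideanSpace ℝ (Fin 2)) : ℝ :=
  ((w 0 + w 1 - (z 0 + z 1)) ^ 2 + (gapInv (w 0 - w 1) - gapInv (z 0 - z 1)) ^ 2) / 2

theorem steerCost_nonneg (z w : EuclideanSpace ℝ (Fin 2)) : 0 ≤ steerCost z w := by
  unfold steerCost; positivity

theorem steerCost_self (z : EuclideanSpace ℝ (Fin 2)) : steerCost z z = 0 := by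
  simp [steerCost]

theorem steerCost_comm (z w : EuclideanSpace ℝ (Fin 2)) : steerCost z w = steerCost w z := by
  unfold steerCost; ring

theorem eq_of_steerCost_eq_zero {z w : EuclideanSpace ℝ (Fin 2)} (h : steerCost z w = 0) :
    z = w := by
  unfold steerCost at h
  have h1 : w 0 + w 1 = z 0 + z 1 := by
    nlinarith [sq_nonneg (w 0 + w 1 - (z 0 + z 1)),
      sq_nonneg (gapInv (w 0 - w 1) - gapInv (z 0 - z 1))]
  have h2 : gapInv (w 0 - w 1) = gapInv (z 0 - z 1) := by
    nlinarith [sq_nonneg (w 0 + w 1 - (z 0 + z 1)),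
      sq_nonneg (gapInv (w 0 - w 1) - gapInv (z 0 - z 1))]
  rw [← ofSumGap_gapInv z, ← ofSumGap_gapInv w, h1, h2]

theorem continuous_steerCost_left (w : EuclideanSpace ℝ (Fin 2)) :
    Continuous fun z => steerCost z w := by
  have := continuous_gapInv
  unfold steerCost
  fun_prop

theorem exists_isSolution_of_lt {a b : ℝ} (hab : a < b) (z w : EuclideanSpace ℝ (Fin 2)) :
    ∃ α x : ℝ → EuclideanSpace ℝ (Fin 2), Measurable α ∧ IsSolution a b α z x ∧ x b = w ∧
      energy a b α ≤ ENNReal.ofReal (steerCost z w / (b - a)) := by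
  simpa only [ofSumGap_gapInv, steerCost] using exists_steering hab (z 0 + z 1) (w 0 + w 1)
    (gapInv (z 0 - z 1)) (gapInv (w 0 - w 1))

/-- Given a solution on `[t, T]` from `y`, there is one on `[s, T]` from `z` with the same endpoint:
it is steered to `y` during `[s, s + δ]` and then runs through the given solution at constant speed
factor `(T - t) / (T - s - δ)`. -/
theorem exists_isSolution_same_endpoint {s t δ T : ℝ} {y z : EuclideanSpace ℝ (Fin 2)}
    {α x : ℝ → EuclideanSpace ℝ (Fin 2)} (ht : 0 ≤ t) (htT : t < T) (hδ : 0 < δ)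
    (hsT : s + δ < T) (hα : AEMeasurable α (volume.restrict (Icc 0 T)))
    (h : IsSolution t T α y x) :
    ∃ β w : ℝ → EuclideanSpace ℝ (Fin 2), AEMeasurable β (volume.restrict (Icc 0 T)) ∧
      IsSolution s T β z w ∧ w T = x T ∧
      energy s T β ≤ ENNReal.ofReal (steerCost z y / δ) +
        ENNReal.ofReal ((T - t) / (T - s - δ)) * energy t T α := by
  obtain ⟨α₁, x₁, hm₁, h₁, hx₁, he₁⟩ := exists_isSolution_of_lt (lt_add_of_pos_right s hδ) z y
  have hpos : 0 < T - s - δ := by linarith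
  set k := (T - t) / (T - s - δ) with hk
  have hk0 : 0 < k := div_pos (sub_pos.2 htT) hpos
  have hkT : t + k * (T - (s + δ)) = T := by
    rw [← sub_sub, hk, div_mul_cancel₀ _ hpos.ne']; ring
  have h₂ : IsSolution (s + δ) T (fun r => k • α (t + k * (r - (s + δ)))) (x₁ (s + δ))
      (fun r => x (t + k * (r - (s + δ)))) := by
    rw [hx₁]
    exact IsSolution.comp_affine hk0 hsT.le (by rwa [hkT])
  refine ⟨_, _, aemeasurable_glue hm₁.aemeasurable
    (aemeasurable_comp_affine (e := 0) hk0 ht (by rwa [hkT])),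
    IsSolution.glue (le_add_of_nonneg_right hδ.le) hsT.le h₁ h₂, ?_, ?_⟩
  · rw [piecewise_eq_of_notMem _ _ _ (by simpa using hsT), hkT]
  · refine energy_glue_le.trans (add_le_add (by simpa using he₁) (le_of_eq ?_))
    rw [energy_comp_affine hk0, hkT]

theorem exists_steering_sequence {T t₀ : ℝ} (ht₀ : t₀ < T) {y₀ : EuclideanSpace ℝ (Fin 2)}
    {y : ℕ → EuclideanSpace ℝ (Fin 2)} (hy : Tendsto y atTop (𝓝 y₀)) :
    ∃ (τ : ℕ → ℝ) (α x : ℕ → ℝ → EuclideanSpace ℝ (Fin 2)),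
      (∀ᶠ n in atTop, τ n ∈ Icc t₀ T ∧ AEMeasurable (α n) (volume.restrict (Ico t₀ (τ n))) ∧
        IsSolution t₀ (τ n) (α n) (y n) (x n) ∧ x n (τ n) = y₀) ∧
      Tendsto τ atTop (𝓝 t₀) ∧
      Tendsto (fun n => energy t₀ (τ n) (α n)) atTop (𝓝 0) := by
  set D : ℕ → ℝ := fun n => steerCost (y n) y₀ with hD
  have hD0 : ∀ n, 0 ≤ D n := fun n => steerCost_nonneg _ _
  have hDlim : Tendsto (fun n => √(D n)) atTop (𝓝 0) := by
    have := ((continuous_steerCost_left y₀).sqrt.tendsto y₀).comp hy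
    simpa [steerCost_self, Function.comp_def] using this
  -- The term `1 / (n + 1)` keeps the steering time positive when `y n = y₀`.
  set δ : ℕ → ℝ := fun n => √(D n) + 1 / ((n : ℝ) + 1) with hδ
  have hδ0 : ∀ n, 0 < δ n := fun n => by positivity
  have hδlim : Tendsto δ atTop (𝓝 0) := by
    simpa [hδ] using hDlim.add tendsto_one_div_add_atTop_nhds_zero_nat
  have hsteer := fun n => exists_isSolution_of_lt (lt_add_of_pos_right t₀ (hδ0 n)) (y n) y₀
  choose α x hα hsol hend hen using hsteer
  refine ⟨fun n => t₀ + δ n, α, x, ?_, by simpa using hδlim.const_add t₀, ?_⟩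
  · filter_upwards [hδlim.eventually_le_const (sub_pos.2 ht₀)] with n hn
    exact ⟨⟨(lt_add_of_pos_right t₀ (hδ0 n)).le, by linarith⟩, (hα n).aemeasurable, hsol n, hend n⟩
  · have hlim : Tendsto (fun n => ENNReal.ofReal √(D n)) atTop (𝓝 0) := by
      simpa using ENNReal.tendsto_ofReal hDlim
    refine tendsto_of_tendsto_of_tendsto_of_le_of_le tendsto_const_nhds hlim
      (fun _ => bot_le) fun n => (hen n).trans (ENNReal.ofReal_le_ofReal ?_)
    rw [add_sub_cancel_left, div_le_iff₀ (hδ0 n)]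
    calc D n = √(D n) * √(D n) := (Real.mul_self_sqrt (hD0 n)).symm
      _ ≤ √(D n) * δ n := by
        have : (0 : ℝ) ≤ 1 / ((n : ℝ) + 1) := by positivity
        exact mul_le_mul_of_nonneg_left (by simp only [hδ]; linarith) (Real.sqrt_nonneg _)

end Multipeakon

/-! ### The value function -/

namespace Multipeakon

section Value

variable {T C : ℝ} {g : EuclideanSpace ℝ (Fin 2) → ℝ}

theorem isSolution_const (a b : ℝ) (y : EuclideanSpace ℝ (Fin 2)) :
    IsSolution a b 0 y fun _ => y where
  absolutelyContinuous :=
    ((LipschitzWith.const y).lipschitzOnWith (s := uIcc a b)).absolutelyContinuousOnInterval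
  hasDerivAt := Eventually.of_forall fun t => by simpa using hasDerivAt_const t y
  initial := rfl

theorem cost_eq_coe {t : ℝ} {α x : ℝ → EuclideanSpace ℝ (Fin 2)} (h : energy t T α ≠ ⊤) :
    cost T g t α x = (((energy t T α).toReal / 2 + g (x T) : ℝ) : EReal) := by
  have h2 : energy t T α / 2 ≠ ⊤ := ENNReal.div_ne_top h two_ne_zero
  rw [cost, EReal.coe_add, ← EReal.coe_toReal (EReal.coe_ennreal_eq_top_iff.not.2 h2)
    (EReal.coe_ennreal_ne_bot _), EReal.toReal_coe_ennreal, ENNReal.toReal_div]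
  rfl

theorem cost_eq_top {t : ℝ} {α x : ℝ → EuclideanSpace ℝ (Fin 2)} (h : energy t T α = ⊤) :
    cost T g t α x = ⊤ := by
  rw [cost, h, ENNReal.top_div_of_ne_top ENNReal.ofNat_ne_top, EReal.coe_ennreal_top,
    EReal.top_add_coe]

theorem infCost_le_coe (y : EuclideanSpace ℝ (Fin 2)) (t : ℝ) : infCost T g y t ≤ g y := by
  refine sInf_le ⟨0, fun _ => y, aemeasurable_const, isSolution_const t T y, ?_⟩
  simp [cost, energy]

theorem coe_neg_le_infCost (hC : ∀ z, |g z| ≤ C) (y : EuclideanSpace ℝ (Fin 2)) (t : ℝ) :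
    ((-C : ℝ) : EReal) ≤ infCost T g y t := by
  refine le_sInf ?_
  rintro _ ⟨α, x, -, -, rfl⟩
  calc ((-C : ℝ) : EReal) ≤ (g (x T) : EReal) := EReal.coe_le_coe_iff.2 (abs_le.1 (hC _)).1
    _ ≤ cost T g t α x := by
      rw [cost]
      exact le_add_of_nonneg_left (EReal.coe_ennreal_nonneg _)

theorem coe_value (hC : ∀ z, |g z| ≤ C) (y : EuclideanSpace ℝ (Fin 2)) (t : ℝ) :
    (value T g y t : EReal) = infCost T g y t :=
  EReal.coe_toReal ((infCost_le_coe y t).trans_lt (EReal.coe_lt_top _)).ne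
    ((EReal.bot_lt_coe _).trans_le (coe_neg_le_infCost hC y t)).ne'

theorem value_le (hC : ∀ z, |g z| ≤ C) (y : EuclideanSpace ℝ (Fin 2)) (t : ℝ) :
    value T g y t ≤ g y := by
  rw [← EReal.coe_le_coe_iff, coe_value hC]
  exact infCost_le_coe y t

theorem abs_value_le (hC : ∀ z, |g z| ≤ C) (y : EuclideanSpace ℝ (Fin 2)) (t : ℝ) :
    |value T g y t| ≤ C := by
  refine abs_le.2 ⟨?_, (value_le hC y t).trans (abs_le.1 (hC y)).2⟩
  rw [← EReal.coe_le_coe_iff, coe_value hC]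
  exact coe_neg_le_infCost hC y t

theorem value_le_of_isSolution (hC : ∀ z, |g z| ≤ C) {y : EuclideanSpace ℝ (Fin 2)} {t : ℝ}
    {α x : ℝ → EuclideanSpace ℝ (Fin 2)} (hα : AEMeasurable α (volume.restrict (Icc 0 T)))
    (h : IsSolution t T α y x) (hfin : energy t T α ≠ ⊤) :
    value T g y t ≤ (energy t T α).toReal / 2 + g (x T) := by
  rw [← EReal.coe_le_coe_iff, coe_value hC, ← cost_eq_coe hfin]
  exact sInf_le ⟨α, x, hα, h, rfl⟩

theorem exists_lt_value_add (hC : ∀ z, |g z| ≤ C) (y : EuclideanSpace ℝ (Fin 2)) (t : ℝ) {ε : ℝ}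
    (hε : 0 < ε) :
    ∃ α x : ℝ → EuclideanSpace ℝ (Fin 2), AEMeasurable α (volume.restrict (Icc 0 T)) ∧
      IsSolution t T α y x ∧ energy t T α ≠ ⊤ ∧
      (energy t T α).toReal / 2 + g (x T) < value T g y t + ε := by
  have hlt : infCost T g y t < ((value T g y t + ε : ℝ) : EReal) := by
    rw [← coe_value hC, EReal.coe_lt_coe_iff]
    linarith
  obtain ⟨_, ⟨α, x, hα, h, rfl⟩, hc⟩ := sInf_lt_iff.1 hlt
  have hfin : energy t T α ≠ ⊤ := fun htop => by
    rw [cost_eq_top htop] at hc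
    exact not_top_lt hc
  rw [cost_eq_coe hfin, EReal.coe_lt_coe_iff] at hc
  exact ⟨α, x, hα, h, hfin, hc⟩

/-- A priori energy bound for near-optimal controls. -/
theorem energy_le_of_lt_value_add (hC : ∀ z, |g z| ≤ C) {y : EuclideanSpace ℝ (Fin 2)} {t ε : ℝ}
    {α x : ℝ → EuclideanSpace ℝ (Fin 2)} (hε : ε ≤ 1)
    (h : (energy t T α).toReal / 2 + g (x T) < value T g y t + ε) :
    (energy t T α).toReal / 2 ≤ 2 * C + 1 := by
  linarith [(abs_le.1 (abs_value_le (T := T) hC y t)).2, (abs_le.1 (hC (x T))).1]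

/-- Comparison of the values at two points. The constant `2 * C + 1` bounds half the energy of
near-optimal controls, `|k - 1|` the relative energy change caused by the speed factor `k`. -/
theorem value_le_value_add (hC : ∀ z, |g z| ≤ C) {s t δ : ℝ} {y z : EuclideanSpace ℝ (Fin 2)}
    (ht : 0 ≤ t) (htT : t < T) (hδ : 0 < δ) (hsT : s + δ < T) :
    value T g z s ≤ value T g y t + steerCost z y / δ / 2 +
      |(T - t) / (T - s - δ) - 1| * (2 * C + 1) := by
  refine le_of_forall_pos_lt_add fun ε' hε' => ?_
  set ε := min ε' 1
  obtain ⟨α, x, hα, h, hfin, hlt⟩ := exists_lt_value_add (T := T) hC y t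
    (lt_min hε' one_pos : 0 < ε)
  have hen := energy_le_of_lt_value_add hC (min_le_right _ _) hlt
  obtain ⟨β, w, hβ, hw, hwT, hβe⟩ :=
    exists_isSolution_same_endpoint (z := z) ht htT hδ hsT hα h
  set k := (T - t) / (T - s - δ) with hk
  have hk0 : 0 ≤ k := div_nonneg (by linarith) (by linarith)
  have hst : 0 ≤ steerCost z y / δ := div_nonneg (steerCost_nonneg _ _) hδ.le
  have hβe' : energy s T β ≤
      ENNReal.ofReal (steerCost z y / δ + k * (energy t T α).toReal) := by
    rwa [ENNReal.ofReal_add hst (by positivity), ENNReal.ofReal_mul hk0,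
      ENNReal.ofReal_toReal hfin]
  have hβr : (energy s T β).toReal ≤ steerCost z y / δ + k * (energy t T α).toReal :=
    ENNReal.toReal_le_of_le_ofReal (by positivity) hβe'
  have hv := value_le_of_isSolution hC hβ hw (hβe'.trans_lt ENNReal.ofReal_lt_top).ne
  rw [hwT] at hv
  have hkE : (k - 1) * ((energy t T α).toReal / 2) ≤ |k - 1| * (2 * C + 1) :=
    (mul_le_mul_of_nonneg_right (le_abs_self _) (by positivity)).trans
      (mul_le_mul_of_nonneg_left hen (abs_nonneg _))
  have : ε ≤ ε' := min_le_left _ _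
  linarith

theorem continuousWithinAt_value_of_lt (hC : ∀ z, |g z| ≤ C) {y₀ : EuclideanSpace ℝ (Fin 2)}
    {t₀ : ℝ} (ht₀ : 0 ≤ t₀) (ht₀T : t₀ < T) :
    ContinuousWithinAt (fun p : EuclideanSpace ℝ (Fin 2) × ℝ => value T g p.1 p.2)
      (univ ×ˢ Icc 0 T) (y₀, t₀) := by
  set D : EuclideanSpace ℝ (Fin 2) × ℝ → ℝ := fun p => steerCost p.1 y₀ with hD
  have hDc : Continuous D := (continuous_steerCost_left y₀).comp continuous_fst
  have hD0 : ∀ p, 0 ≤ D p := fun p => steerCost_nonneg _ _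
  have hDz : D (y₀, t₀) = 0 := steerCost_self _
  -- A steering time that tends to `0`, but so slowly that `D / δ ≤ √D` tends to `0` as well.
  set δ : EuclideanSpace ℝ (Fin 2) × ℝ → ℝ := fun p => √(D p) + |p.2 - t₀| with hδ
  have hδc : Continuous δ := by fun_prop
  have hδz : δ (y₀, t₀) = 0 := by simp [hδ, hDz]
  set R : EuclideanSpace ℝ (Fin 2) × ℝ → ℝ := fun p => √(D p) / 2 +
    (|(T - t₀) / (T - p.2 - δ p) - 1| + |(T - p.2) / (T - t₀ - δ p) - 1|) * (2 * C + 1) with hR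
  have hT0 : T - t₀ ≠ 0 := (sub_pos.2 ht₀T).ne'
  have hRz : R (y₀, t₀) = 0 := by simp [hR, hDz, hδz, hT0]
  have hRc : ContinuousAt R (y₀, t₀) := by
    have h1 : ContinuousAt (fun p : EuclideanSpace ℝ (Fin 2) × ℝ =>
        (T - t₀) / (T - p.2 - δ p)) (y₀, t₀) :=
      continuousAt_const.div (by fun_prop) (by simpa [hδz] using hT0)
    have h2 : ContinuousAt (fun p : EuclideanSpace ℝ (Fin 2) × ℝ =>
        (T - p.2) / (T - t₀ - δ p)) (y₀, t₀) :=
      ContinuousAt.div (by fun_prop) (by fun_prop) (by simpa [hδz] using hT0)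
    exact (hDc.sqrt.continuousAt.div_const 2).add
      (((h1.sub continuousAt_const).abs.add (h2.sub continuousAt_const).abs).mul
        continuousAt_const)
  have hRlim : Tendsto R (𝓝[univ ×ˢ Icc 0 T] (y₀, t₀)) (𝓝 0) := by
    rw [← hRz]
    exact hRc.tendsto.mono_left nhdsWithin_le_nhds
  have hsmall : ∀ᶠ p in 𝓝[univ ×ˢ Icc 0 T] (y₀, t₀), p.2 + δ p < T ∧ t₀ + δ p < T := by
    refine eventually_nhdsWithin_of_eventually_nhds (.and ?_ ?_)
    · exact (continuous_snd.add hδc).continuousAt.eventually_lt continuousAt_const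
        (by simpa [hδz] using ht₀T)
    · exact (continuous_const.add hδc).continuousAt.eventually_lt continuousAt_const
        (by simpa [hδz] using ht₀T)
  rw [ContinuousWithinAt, tendsto_iff_dist_tendsto_zero]
  refine squeeze_zero' (Eventually.of_forall fun _ => dist_nonneg) ?_ hRlim
  filter_upwards [hsmall, self_mem_nhdsWithin] with p ⟨hp1, hp2⟩ hp
  have hCpos : 0 ≤ 2 * C + 1 := by linarith [(abs_nonneg _).trans (hC y₀)]
  -- The steering time `δ p` vanishes only at the base point, where there is nothing to steer.
  rcases (show 0 ≤ δ p by positivity).eq_or_lt with h0 | hpos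
  · have hs : √(D p) = 0 := by
      have := abs_nonneg (p.2 - t₀)
      have := Real.sqrt_nonneg (D p)
      simp only [hδ] at h0
      linarith
    have h2 : |p.2 - t₀| = 0 := by simp only [hδ] at h0; linarith
    have hp1 : p.1 = y₀ := eq_of_steerCost_eq_zero ((Real.sqrt_eq_zero (hD0 p)).1 hs)
    have hp2 : p.2 = t₀ := by simpa [sub_eq_zero] using h2
    rw [hp1, hp2, dist_self]
    simp only [hR]
    positivity
  · have hDδ : D p / δ p / 2 ≤ √(D p) / 2 := by
      refine div_le_div_of_nonneg_right ((div_le_iff₀ hpos).2 ?_) zero_le_two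
      calc D p = √(D p) * √(D p) := (Real.mul_self_sqrt (hD0 p)).symm
        _ ≤ √(D p) * δ p := mul_le_mul_of_nonneg_left
          (le_add_of_nonneg_right (abs_nonneg _)) (Real.sqrt_nonneg _)
    have hle := value_le_value_add (g := g) (y := y₀) (z := p.1) hC ht₀ ht₀T hpos hp1
    have hge := value_le_value_add (g := g) (y := p.1) (z := y₀) hC hp.2.1
      (by linarith : p.2 < T) hpos hp2
    rw [steerCost_comm] at hge
    have n1 := mul_nonneg (abs_nonneg ((T - t₀) / (T - p.2 - δ p) - 1)) hCpos
    have n2 := mul_nonneg (abs_nonneg ((T - p.2) / (T - t₀ - δ p) - 1)) hCpos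
    rw [Real.dist_eq, abs_le]
    simp only [hR, add_mul]
    constructor <;> linarith

theorem continuousWithinAt_value_terminal (hg : Continuous g) (hC : ∀ z, |g z| ≤ C)
    (y₀ : EuclideanSpace ℝ (Fin 2)) :
    ContinuousWithinAt (fun p : EuclideanSpace ℝ (Fin 2) × ℝ => value T g p.1 p.2)
      (univ ×ˢ Icc 0 T) (y₀, T) := by
  have hnear : ∀ ε > 0, ∀ᶠ p : EuclideanSpace ℝ (Fin 2) × ℝ in 𝓝 (y₀, T),
      p.2 ≤ T → |value T g p.1 p.2 - g y₀| < ε := by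
    intro ε hε
    obtain ⟨ρ, hρ, hgρ⟩ := Metric.continuous_iff.1 hg y₀ (ε / 2) (by positivity)
    set K := 1 + 2 * (2 * C + 1)
    have hsmall : ∀ᶠ p : EuclideanSpace ℝ (Fin 2) × ℝ in 𝓝 (y₀, T),
        dist p.1 y₀ + √(T - p.2) * K < ρ := by
      refine ContinuousAt.eventually_lt (by fun_prop) continuousAt_const ?_
      simpa using hρ
    filter_upwards [hsmall] with p hp hpT
    set η := min (ε / 2) 1
    have hη0 : 0 < η := lt_min (by positivity) one_pos
    have hη1 : η ≤ ε / 2 := min_le_left _ _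
    obtain ⟨α, x, -, h, hfin, hlt⟩ := exists_lt_value_add (T := T) hC p.1 p.2 hη0
    have hen := energy_le_of_lt_value_add hC (min_le_right _ _) hlt
    have hE0 : 0 ≤ (energy p.2 T α).toReal := ENNReal.toReal_nonneg
    have hK : 0 ≤ √(T - p.2) * K := by
      have : 0 ≤ K := by simp only [K]; linarith
      positivity
    have hcoord : ∀ i, |x T i - p.1 i| ≤ √(T - p.2) / 2 * K := fun i =>
      (h.abs_sub_le hpT hfin i).trans
        (mul_le_mul_of_nonneg_left (by simp only [K]; linarith) (by positivity))
    have hdist : dist (x T) p.1 ≤ √(T - p.2) * K := by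
      rw [EuclideanSpace.dist_eq, Fin.sum_univ_two, Real.dist_eq, Real.dist_eq]
      refine Real.sqrt_le_iff.2 ⟨hK, ?_⟩
      have h0 := pow_le_pow_left₀ (abs_nonneg _) (hcoord 0) 2
      have h1 := pow_le_pow_left₀ (abs_nonneg _) (hcoord 1) 2
      nlinarith [sq_nonneg (√(T - p.2) * K)]
    have h1 := hgρ (x T) (by linarith [dist_triangle (x T) p.1 y₀])
    have h2 := hgρ p.1 (by linarith)
    rw [Real.dist_eq, abs_lt] at h1 h2
    have h3 := value_le (T := T) hC p.1 p.2
    rw [abs_lt]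
    constructor <;> linarith [h1.1, h1.2, h2.1, h2.2]
  -- At the base point itself the estimate identifies the terminal value.
  have hvT : value T g y₀ T = g y₀ := by
    rw [← sub_eq_zero, ← abs_nonpos_iff]
    exact le_of_forall_pos_lt_add fun ε hε => by
      simpa using (hnear ε hε).self_of_nhds le_rfl
  rw [ContinuousWithinAt, Metric.tendsto_nhds]
  intro ε hε
  filter_upwards [eventually_nhdsWithin_of_eventually_nhds (hnear ε hε), self_mem_nhdsWithin]
    with p hp hpT
  rw [Real.dist_eq, hvT]
  exact hp hpT.2.2

end Value

end Multipeakon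

theorem theorem1p3 (T : ℝ) (hT : 0 < T) (g : EuclideanSpace ℝ (Fin 2) → ℝ)
    (hg : Continuous g) (hgb : ∃ C : ℝ, ∀ z, |g z| ≤ C) :
    -- the infimum defining the value function is finite
    (∀ (y : EuclideanSpace ℝ (Fin 2)) (t : ℝ), t ∈ Icc 0 T →
      (Multipeakon.value T g y t : EReal) = Multipeakon.infCost T g y t) ∧
    -- joint continuity of the value function
    ContinuousOn (fun p : EuclideanSpace ℝ (Fin 2) × ℝ => Multipeakon.value T g p.1 p.2)
      (univ ×ˢ Icc 0 T) ∧
    -- the sup-norm bound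
    (∀ (y : EuclideanSpace ℝ (Fin 2)) (t : ℝ), t ∈ Icc 0 T →
      |Multipeakon.value T g y t| ≤ ⨆ z, |g z|) ∧
    -- steering to an arbitrary limit point, in vanishing time and at vanishing cost
    (∀ (y₀ : EuclideanSpace ℝ (Fin 2)) (t₀ : ℝ), t₀ ∈ Ico 0 T →
      ∀ y : ℕ → EuclideanSpace ℝ (Fin 2), Tendsto y atTop (𝓝 y₀) →
      ∃ (τ : ℕ → ℝ) (α x : ℕ → ℝ → EuclideanSpace ℝ (Fin 2)),
        (∀ᶠ n in atTop, τ n ∈ Icc t₀ T ∧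
          AEMeasurable (α n) (volume.restrict (Ico t₀ (τ n))) ∧
          Multipeakon.IsSolution t₀ (τ n) (α n) (y n) (x n) ∧
          x n (τ n) = y₀) ∧
        Tendsto τ atTop (𝓝 t₀) ∧
        Tendsto (fun n => Multipeakon.energy t₀ (τ n) (α n)) atTop (𝓝 0)) ∧
    -- the explicit square root
    (∀ z : EuclideanSpace ℝ (Fin 2),
      Multipeakon.sqrtE z = (1 / 2 : ℝ) •
        !![√(1 + Real.exp (-|z 0 - z 1|)) + √(1 - Real.exp (-|z 0 - z 1|)),
           √(1 + Real.exp (-|z 0 - z 1|)) - √(1 - Real.exp (-|z 0 - z 1|));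
           √(1 + Real.exp (-|z 0 - z 1|)) - √(1 - Real.exp (-|z 0 - z 1|)),
           √(1 + Real.exp (-|z 0 - z 1|)) + √(1 - Real.exp (-|z 0 - z 1|))]) := by
  obtain ⟨C, hC⟩ := hgb
  refine ⟨fun y t _ => Multipeakon.coe_value hC y t, ?_, fun y t _ => ?_,
    fun y₀ t₀ ht₀ y hy => Multipeakon.exists_steering_sequence ht₀.2 hy,
    Multipeakon.sqrtE_fin_two⟩
  · rintro ⟨y₀, t₀⟩ ⟨-, ht₀⟩
    rcases ht₀.2.eq_or_lt with rfl | hlt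
    · exact Multipeakon.continuousWithinAt_value_terminal hg hC y₀
    · exact Multipeakon.continuousWithinAt_value_of_lt hC ht₀.1 hlt
  · have hbdd : BddAbove (range fun z => |g z|) := ⟨C, by rintro _ ⟨z, rfl⟩; exact hC z⟩
    exact Multipeakon.abs_value_le (fun z => le_ciSup hbdd z) y t
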